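/- Work over $\mathbb C$ and let $n\ge 1$. Let $X=\mathbb A^2\to\mathbb A^1$, $t=xy$, let $X[n]\to\mathbb A^{n+1}$ be its $n$-th family of expanded degenerations and let $W[n]=X[n]\times_{\mathbb A^{n+1}}\cdots\times_{\mathbb A^{n+1}}X[n]$ ($n$ factors). It is regarded as the toric variety with torus $T=(\mathbb C^*)^{2n+1}$, with coordinates $(s_1,\dots,s_n,t_1,\dots,t_{n+1})$ and character lattice $M=\mathbb Z^{2n+1}$, given as follows. Let $P\subset M_{\mathbb R}$ be the convex hull of the exponents of all products of distinct members of the family of $n^2$ Laurent monomials $r_{k,i}=t_{k+1}\cdots t_{n+1}/s_i$ $(1\le k,i\le n)$, let $C$ be the cone generated by the exponents of the monomials $x_i=t_1\cdots t_{n+1}/s_i$, $y_i=s_i$ $(1\le i\le n)$ and $t_j$ $(1\le j\le n+1)$, and let $\tilde P=P+C$. Then $W[n]=\operatorname{Proj}S$ with $S=\bigoplus_{k\ge0}S_k$, where $S_k=\bigoplus_{m\in (kP+C)\cap M}\mathbb C\,\chi^m=H^0(W[n],L^{\otimes k})$ and $L=\mathcal O(1)$. Let $G[n]=\{(t_1,\dots,t_{n+1})\in(\mathbb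 C^*)^{n+1}\mid t_1\cdots t_{n+1}=1\}\subset T$, with coordinates $\tau_i=t_1\cdots t_i$ $(1\le i\le n)$; in the dual basis of characters of $G[n]$, restriction of characters from $T$ to $G[n]$ is the map $\alpha:M\to\mathbb Z^n$, $\alpha(m)_i=m_{t_i}-m_{t_{i+1}}$. The GHH linearization is the fractional linearization of $L$ given by $b=\left(\frac{n}{n+1},\frac{2n}{n+1},\dots,\frac{n^2}{n+1}\right)$: for $(n+1)\mid k$, the group $G[n]$ acts on $\chi^m\in S_k$ through the character $\alpha(m)+kb$. The semistable locus $W[n]^{ss}$ is the set of points at which some $G[n]$-invariant section in $S_k$, for some $k>0$ with $(n+1)\mid k$, does not vanish. For $I\subset\{1,\dots,n\}$ (possibly empty) and $j\in\{0,1,\dots,n\}$, let $v_{I,j}=(e_I,e_{j+1})\in\mathbb Z^n\oplus\mathbb Z^{n+1}$, where $e_I=\sum_{i\in I}e_i$, let $D_{I,j}$ be the torus-invariant divisor of $W[n]$ corresponding to the ray spanned by $v_{I,j}$ (so $D_{I,j}$ lies over $t_{j+1}=0$), and let $d_{I,j}=\min_{u\in P}\langle v_{I,j},u\rangle$. For $k\ge1$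 let $$\Lambda_{b,k}=\Big\{\sum_{I,j}\big(\langle v_{I,j},m\rangle-k\,d_{I,j}\big)D_{I,j}\ \Big|\ m\in (kP+C)\cap M,\ \alpha(m)=-kb\Big\}$$ be the system of divisors of the $G[n]$-invariant monomial sections of $L^{\otimes k}$, and let $\operatorname{Bs}(\Lambda_{b,k})$ be the intersection of the supports of its members (all of $W[n]$ if $\Lambda_{b,k}=\emptyset$). Then the stable base locus and the locus of unstable points with respect to the GHH linearization coincide and are given by $$\bigcap_{k\ge1}\operatorname{Bs}(\Lambda_{b,k})=W[n]\setminus W[n]^{ss}=\bigcup_{\#(I)\ne j}D_{I,j},$$ the union being over all $I\subset\{1,\dots,n\}$ and $j\in\{0,\dots,n\}$ with $\#(I)\ne j$. -/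

import Mathlib

open AlgebraicGeometry
open scoped Pointwise

noncomputable section

/-! ## Toric varieties of lattice polyhedra -/

/-- A lattice polyhedron on the character lattice `M = ℤ^ι`, presented as the Minkowski sum of the
lattice polytope `conv(vertices)` and the rational polyhedral cone spanned by `generators`. -/
structure LatticePolyhedron (ι : Type) where
  vertices : Finset (ι → ℤ)
  vertices_nonempty : vertices.Nonempty
  generators : Finset (ι → ℤ)

namespace LatticePolyhedron

variable {ι : Type}

/-- The inclusion `M = ℤ^ι → M_ℝ = ℝ^ι`. -/
def toReal (m : ι → ℤ) : ι → ℝ := fun i => (m i : ℝ)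

variable (P : LatticePolyhedron ι)

/-- The polytopal part. -/
def polytope : Set (ι → ℝ) := convexHull ℝ (toReal '' (P.vertices : Set (ι → ℤ)))

/-- The recession cone. -/
def recessionCone : PointedCone ℝ (ι → ℝ) :=
  PointedCone.hull ℝ (toReal '' (P.generators : Set (ι → ℤ)))

/-- The slice `t P + C` at height `t` of the cone over the polyhedron `P + C`. It is the polyhedron
itself for `t = 1` and the recession cone `C` for `t = 0`. -/
def slice (t : ℝ) : Set (ι → ℝ) := t • P.polytope + (P.recessionCone : Set (ι → ℝ))

theorem polytope_nonempty : P.polytope.Nonempty :=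
  (P.vertices_nonempty.to_set.image toReal).convexHull

theorem zero_mem_slice : (0 : ι → ℝ) ∈ P.slice 0 := by
  obtain ⟨u, hu⟩ := P.polytope_nonempty
  exact ⟨(0 : ℝ) • u, Set.smul_mem_smul_set hu, 0, P.recessionCone.zero_mem, by simp⟩

theorem add_mem_slice {s t : ℝ} (hs : 0 ≤ s) (ht : 0 ≤ t) {x y : ι → ℝ}
    (hx : x ∈ P.slice s) (hy : y ∈ P.slice t) : x + y ∈ P.slice (s + t) := by
  obtain ⟨p, hp, c, hc, rfl⟩ := hx
  obtain ⟨q, hq, d, hd, rfl⟩ := hy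
  refine ⟨p + q, ?_, c + d, P.recessionCone.add_mem hc hd, by simp [add_add_add_comm]⟩
  have h : Convex ℝ P.polytope := convex_convexHull ℝ _
  change p + q ∈ (s + t) • P.polytope
  rw [h.add_smul hs ht]
  exact Set.add_mem_add hp hq

/-- The semigroup of lattice points `(m, k)`, with `k ∈ ℕ`, of the cone over the polyhedron. -/
def semigroup : AddSubmonoid ((ι → ℤ) × ℕ) where
  carrier := {a | toReal a.1 ∈ P.slice a.2}
  zero_mem' := by
    have h : toReal (0 : ι → ℤ) = 0 := by ext; simp [toReal]
    simpa [h] using P.zero_mem_slice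
  add_mem' := by
    intro a b ha hb
    have h : toReal (a.1 + b.1) = toReal a.1 + toReal b.1 := by ext; simp [toReal]
    simpa [h] using P.add_mem_slice (Nat.cast_nonneg a.2) (Nat.cast_nonneg b.2) ha hb

/-- The graded ring `S = ℂ[C(P) ∩ (M × ℤ)]`. -/
abbrev ring : Type := AddMonoidAlgebra ℂ P.semigroup

/-- The height `(m, k) ↦ k`. -/
def degree : P.semigroup →+ ℕ := (AddMonoidHom.snd (ι → ℤ) ℕ).comp P.semigroup.subtype

/-- The graded piece `S_k`, spanned by the `χ^m` with `m` a lattice point of `k P + C`. It is the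
space of global sections of the `k`-th power of the line bundle `L = 𝒪(1)`. -/
abbrev sections (k : ℕ) : Submodule ℂ P.ring := AddMonoidAlgebra.gradeBy ℂ P.degree k

/-- The monomial section `χ^m ∈ S_k` for `a = (m, k)`. -/
def monomial (a : P.semigroup) : P.ring := AddMonoidAlgebra.single a 1

/-- The toric variety `X(P) = Proj S` of the polyhedron. -/
def variety : Scheme := Proj P.sections

/-- The open set of points of `X(P)` where a homogeneous element of `S` does not vanish. -/
def nonvanishing (f : P.ring) : Set P.variety := (Proj.basicOpen P.sections f : Set (Proj P.sections))

variable [Fintype ι]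

/-- The pairing of one-parameter subgroups `N = ℤ^ι` with characters `M = ℤ^ι`. -/
def pairing (v m : ι → ℤ) : ℤ := ∑ i, v i * m i

/-- The constant `d_v`: the minimum over the polytope of the functional `v`. It is attained at a
vertex. If `v` is non-negative on the recession cone, it is also the minimum over the polyhedron. -/
def minValue (v : ι → ℤ) : ℤ := P.vertices.inf' P.vertices_nonempty (pairing v)

/-- The coefficient `⟨v, m⟩ - k d_v`: the order of vanishing of the section `χ^m ∈ S_k` along the
torus-invariant divisor of the ray spanned by `v`. -/
def vanishingOrder (v : ι → ℤ) (a : P.semigroup) : ℤ :=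
  pairing v a.1.1 - a.1.2 * P.minValue v

/-- The torus-invariant divisor of `X(P)` corresponding to a ray of the normal fan with primitive
generator `v`, that is, to the facet `⟨v, m⟩ = d_v`: the common zero locus of all monomial sections
whose exponent is off the (cone over the) facet. -/
def divisor (v : ι → ℤ) : Set P.variety :=
  {x | ∀ a : P.semigroup, 0 < P.vanishingOrder v a → x ∉ P.nonvanishing (P.monomial a)}

/-- The character `χ^m` of the torus `T = (ℂˣ)^ι`. -/
def character (m : ι → ℤ) (z : ι → ℂˣ) : ℂˣ := ∏ i, z i ^ m i

theorem character_zero (z : ι → ℂˣ) : character (0 : ι → ℤ) z = 1 := by simp [character]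

theorem character_add (m m' : ι → ℤ) (z : ι → ℂˣ) :
    character (m + m') z = character m z * character m' z := by
  simp [character, zpow_add, Finset.prod_mul_distrib]

/-- The (dual) action of the torus on the graded ring, `z · χ^m = χ^m(z) χ^m`. -/
def torusAction (z : ι → ℂˣ) : P.ring →ₐ[ℂ] P.ring :=
  AddMonoidAlgebra.lift ℂ P.ring P.semigroup
    { toFun := fun a => AddMonoidAlgebra.single a.toAdd (character a.toAdd.1.1 z : ℂ)
      map_one' := by simp [character_zero, AddMonoidAlgebra.one_def]
      map_mul' := fun a b => by simp [character_add, AddMonoidAlgebra.single_mul_single] }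

end LatticePolyhedron

/-! ## The self-product of the expanded degeneration -/

namespace ExpandedDegeneration

/-- The coordinates `(s_1, …, s_n, t_1, …, t_{n+1})` of the torus of `W[n]`: `Sum.inl i` stands for
`s_{i+1}` and `Sum.inr j` for `t_{j+1}`. -/
abbrev Coord (n : ℕ) : Type := Fin n ⊕ Fin (n + 1)

variable (n : ℕ)

/-- The exponent of `x_i = t_1 ⋯ t_{n+1} / s_i`. -/
def xExp (i : Fin n) : Coord n → ℤ := Sum.elim (-Pi.single i 1) 1

/-- The exponent of `y_i = s_i`. -/
def yExp (i : Fin n) : Coord n → ℤ := Sum.elim (Pi.single i 1) 0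

/-- The exponent of `t_j`. -/
def tExp (j : Fin (n + 1)) : Coord n → ℤ := Sum.elim 0 (Pi.single j 1)

/-- The exponent of the ratio `t_{k+1} ⋯ t_{n+1} / s_i` of the homogeneous coordinates on the
`k`-th projective line of the `i`-th factor, for `k = 1, …, n` (the index `k : Fin n` is one less). -/
def ratioExp (k i : Fin n) : Coord n → ℤ :=
  Sum.elim (-Pi.single i 1) (fun j => if k.castSucc < j then 1 else 0)

/-- The polyhedron of `W[n]`. Its vertices are the exponents of the coordinates of the monomial map
to `ℙ^(2^(n²) - 1)` given by the `n²` ratios and the Segre embedding (the images of the vertices of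
the hypercube), and its recession cone is generated by the exponents of the `x_i`, `y_i`, `t_j`. -/
def polyhedron : LatticePolyhedron (Coord n) where
  vertices := (Finset.univ : Finset (Finset (Fin n × Fin n))).image
    fun A => ∑ a ∈ A, ratioExp n a.1 a.2
  vertices_nonempty := Finset.univ_nonempty.image _
  generators := Finset.univ.image (xExp n) ∪ Finset.univ.image (yExp n) ∪ Finset.univ.image (tExp n)

/-- The `n`-fold self-product `W[n]` over `𝔸^(n+1)` of the expanded degeneration `X[n]`, as a toric
variety. -/
def W : Scheme := (polyhedron n).variety

/-- The torus `G[n] = {(t_1, …, t_{n+1}) ∣ t_1 ⋯ t_{n+1} = 1}`. -/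
def G : Subgroup (Fin (n + 1) → ℂˣ) where
  carrier := {t | ∏ j, t j = 1}
  one_mem' := by simp
  mul_mem' := by
    intro a b ha hb
    simp only [Set.mem_ofPred_eq] at ha hb ⊢
    simp [Finset.prod_mul_distrib, ha, hb]
  inv_mem' := by
    intro a ha
    simp only [Set.mem_ofPred_eq] at ha ⊢
    simp [ha]

variable {n}

/-- `G[n]` as a subtorus of the torus of `W[n]`, through the coordinates `t_j`. -/
def toTorus (g : G n) : Coord n → ℂˣ := Sum.elim 1 g.1

/-- The coordinates `τ_i = t_1 ⋯ t_i` of `G[n]`, for `i = 1, …, n` (the index `i : Fin n` is one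
less). -/
def tau (g : G n) (i : Fin n) : ℂˣ := ∏ j ∈ Finset.Iic i.castSucc, g.1 j

variable (n)

/-- The vector `b = (n/(n+1), 2n/(n+1), …, n²/(n+1))` of the fractional GHH linearization on
`W[n]`, in the basis of characters of `G[n]` dual to `τ`. -/
def ghhVector (i : Fin n) : ℚ := ((i : ℚ) + 1) * n / (n + 1)

/-- The linear part `α` of the GHH linearization: the restriction of characters of the torus of
`W[n]` to `G[n]`, in the basis dual to `τ`. -/
def alpha (m : Coord n → ℤ) (i : Fin n) : ℤ := m (Sum.inr i.castSucc) - m (Sum.inr i.succ)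

variable {n}

/-- The character `τ ↦ ∏ τ_i ^ (i n)` of `G[n]`, which is `(n + 1) b`. -/
def ghhCharacter (g : G n) : ℂˣ := ∏ i : Fin n, tau g i ^ (((i : ℕ) + 1) * n)

/-- The action of `G[n]` on sections of `L^((n+1) q)` given by the GHH linearization: `χ^m` has
weight `α(m) + (n + 1) q b`. -/
def ghhAction (q : ℕ) (g : G n) (f : (polyhedron n).ring) : (polyhedron n).ring :=
  ((ghhCharacter g ^ q : ℂˣ) : ℂ) • (polyhedron n).torusAction (toTorus g) f

variable (n)

/-- The semistable locus `W[n]^ss` for the GHH linearization: the points at which some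
`G[n]`-invariant section of a positive power of `L^(n+1)` does not vanish. (The non-vanishing locus
of a section of a positive power of the ample bundle `L` is automatically affine.) -/
def semistableLocus : Set (W n) :=
  {x | ∃ q : ℕ, 0 < q ∧ ∃ f ∈ (polyhedron n).sections ((n + 1) * q),
    (∀ g : G n, ghhAction q g f = f) ∧ x ∈ (polyhedron n).nonvanishing f}

variable {n}

/-- The vector `v_{I,j} = (e_I, e_{j+1})`, for `I ⊆ {1, …, n}` and `j = 0, …, n`. -/
def ray (I : Finset (Fin n)) (j : Fin (n + 1)) : Coord n → ℤ :=
  Sum.elim (fun i => if i ∈ I then 1 else 0) (Pi.single j 1)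

/-- The torus-invariant divisor `D_{I,j}` of `W[n]`. -/
def D (I : Finset (Fin n)) (j : Fin (n + 1)) : Set (W n) := (polyhedron n).divisor (ray I j)

variable (n)

/-- Torus-invariant Weil divisors `∑ c_{I,j} D_{I,j}` on `W[n]`. -/
abbrev InvariantDivisor : Type := Finset (Fin n) → Fin (n + 1) → ℤ

variable {n}

/-- The support of a torus-invariant divisor. -/
def InvariantDivisor.support (c : InvariantDivisor n) : Set (W n) :=
  ⋃ (I : Finset (Fin n)) (j : Fin (n + 1)) (_ : c I j ≠ 0), D I j

variable (n)

/-- The system `Λ_{b,k}` of the divisors `∑ (⟨v_{I,j}, m⟩ - k d_{I,j}) D_{I,j}` of the invariant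
monomial sections of `L^k`: `m` runs over the lattice points of `k P_b`, where `P_b` is the part of
the polyhedron on which `α = -b`. -/
def invariantSystem (k : ℕ) : Set (InvariantDivisor n) :=
  {c | ∃ a : (polyhedron n).semigroup, a.1.2 = k ∧
    (∀ i, (alpha n a.1.1 i : ℚ) = -(k * ghhVector n i)) ∧
    c = fun I j => (polyhedron n).vanishingOrder (ray I j) a}

/-- The stable base locus `⋂_{k ≥ 1} Bs(Λ_{b,k})`. -/
def stableBaseLocus : Set (W n) :=
  ⋂ (k : ℕ) (_ : 0 < k), ⋂ c ∈ invariantSystem n k, InvariantDivisor.support c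

end ExpandedDegeneration

end

/-!
Call a monomial section of `L^k` invariant if its exponent satisfies `α(m) = -kb`. The torus `G[n]`
acts diagonally on monomials, so the monomials of a `G[n]`-invariant section are invariant
(`alpha_eq_of_ghhAction_eq`), and both loci are governed by the vanishing of invariant monomials.

If `#I ≠ j`, every invariant monomial of positive degree vanishes on `D_{I,j}`: invariance fixes the
differences of the `t`-exponents, hence the difference of the orders of vanishing along `D_{I,j}` and
`D_{I,#I}`, which turns out to be positive (`vanishingOrder_ray_pos`). So the union of these
divisors lies in the stable base locus and in the unstable locus.

Conversely, let `x` lie on no `D_{I,j}` with `#I ≠ j`. The exponents of the monomials that do not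
vanish at `x` form a face of the semigroup of `S`. By assumption this face contains an element `a` of
positive degree whose order along every `D_{I,j}` with `#I ≠ j` is positive. If the order of `a` along
`D_{I,j}` is zero, then adding an element to `I` or removing one makes it positive, which forces `I`
to consist of the `j` smallest among the `s`-exponents of `a`. Hence all these sets `I` belong to one
complete flag (`exists_perm_of_vanishingOrder_pos`). For each complete flag there is an explicit
invariant monomial of order zero along the divisors of the flag (`flagSection`). As the inequalities of
the rays `v_{I,j}` cut out the polyhedron (`mem_semigroup_of_rayOrder_nonneg`), this monomial divides a
power of `χ^a`, so it does not vanish at `x` (`exists_flagSection_mem_nonvanishingFace`). Thus `x` is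
semistable, and, the invariant monomial having positive order along every divisor `D_{I,j}` of its
support, `x` is not in the stable base locus.
-/

/-! ### Monomial sections on the toric variety of a polyhedron -/

namespace LatticePolyhedron

variable {ι : Type} (P : LatticePolyhedron ι)

theorem mem_nonvanishing {f : P.ring} {x : P.variety} :
    x ∈ P.nonvanishing f ↔ f ∉ ProjectiveSpectrum.asHomogeneousIdeal (𝒜 := P.sections) x :=
  Iff.rfl

/-- The exponents of the monomial sections that do not vanish at a point of `X(P)`. They form a face
of the semigroup: see `mem_nonvanishingFace_of_add_mem`. -/
def nonvanishingFace (x : P.variety) : AddSubmonoid P.semigroup where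
  carrier := {a | x ∈ P.nonvanishing (P.monomial a)}
  zero_mem' := by
    have h := (ProjectiveSpectrum.isPrime (𝒜 := P.sections) x).one_notMem
    exact h
  add_mem' := by
    intro a b ha hb
    have h : P.monomial (a + b) = P.monomial a * P.monomial b := by
      simp [monomial, AddMonoidAlgebra.single_mul_single]
    change x ∈ P.nonvanishing (P.monomial (a + b))
    rw [h]
    exact fun hab => ((ProjectiveSpectrum.isPrime (𝒜 := P.sections) x).mem_or_mem hab).elim ha hb

theorem mem_nonvanishingFace {x : P.variety} {a : P.semigroup} :
    a ∈ P.nonvanishingFace x ↔ x ∈ P.nonvanishing (P.monomial a) := Iff.rfl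

theorem mem_nonvanishingFace_of_add_mem {x : P.variety} {a b : P.semigroup}
    (h : a + b ∈ P.nonvanishingFace x) : a ∈ P.nonvanishingFace x := by
  have hm : P.monomial (a + b) = P.monomial a * P.monomial b := by
    simp [monomial, AddMonoidAlgebra.single_mul_single]
  rw [mem_nonvanishingFace, mem_nonvanishing] at h ⊢
  rw [hm] at h
  exact fun ha => h (Ideal.mul_mem_right _ _ ha)

/-- Homogeneous prime ideals are closed under linear combinations, so a section that does not vanish
at a point has a monomial that does not vanish there. -/
theorem exists_mem_nonvanishingFace {x : P.variety} {f : P.ring} (hf : x ∈ P.nonvanishing f) :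
    ∃ a ∈ f.coeff.support, a ∈ P.nonvanishingFace x := by
  by_contra! h
  refine hf ?_
  have hs : f = ∑ a ∈ f.coeff.support, f.coeff a • P.monomial a := by
    conv_lhs => rw [← AddMonoidAlgebra.sum_coeff_single f]
    simp [Finsupp.sum, monomial]
  change f ∈ (ProjectiveSpectrum.asHomogeneousIdeal (𝒜 := P.sections) x).toIdeal
  rw [hs]
  refine Ideal.sum_mem _ fun a ha => ?_
  rw [Algebra.smul_def]
  exact Ideal.mul_mem_left _ _ (not_not.1 (h a ha))

/-- A point of `Proj S` does not contain the irrelevant ideal, so some monomial section of positive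
degree does not vanish there. -/
theorem exists_degree_pos_mem_nonvanishingFace (x : P.variety) :
    ∃ a ∈ P.nonvanishingFace x, 0 < a.1.2 := by
  by_contra! h
  refine ProjectiveSpectrum.not_irrelevant_le (𝒜 := P.sections) x ?_
  rw [HomogeneousIdeal.irrelevant_le]
  intro k hk f hf
  by_contra hfx
  obtain ⟨a, ha, hax⟩ := P.exists_mem_nonvanishingFace (f := f) (x := x) hfx
  have h1 : a.1.2 = k := hf a ha
  have h2 := h a hax
  omega

theorem coeff_torusAction (z : ι → ℂˣ) [Fintype ι] (f : P.ring) (a : P.semigroup) :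
    (P.torusAction z f).coeff a = character a.1.1 z * f.coeff a := by
  induction f using AddMonoidAlgebra.induction_linear with
  | zero => simp
  | add f g hf hg => simp [hf, hg, mul_add]
  | single b r =>
    classical
    rw [torusAction, AddMonoidAlgebra.lift_single]
    by_cases hab : b = a
    · subst hab; simp [mul_comm]
    · simp [hab]

/-! ### Orders of vanishing along toric divisors -/

section Fintype

variable [Fintype ι]

/-- The pairing with `v` as a homomorphism on the character lattice. -/
def pairingHom (v : ι → ℤ) : (ι → ℤ) →+ ℤ where
  toFun := pairing v
  map_zero' := by simp [pairing]
  map_add' m m' := by simp [pairing, mul_add, Finset.sum_add_distrib]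

/-- The order of vanishing along the divisor of the ray of `v`, as a homomorphism on the
semigroup. -/
def vanishingOrderHom (v : ι → ℤ) : P.semigroup →+ ℤ where
  toFun := P.vanishingOrder v
  map_zero' := by simp [vanishingOrder, pairing]
  map_add' a b := by
    have h := (pairingHom v).map_add a.1.1 b.1.1
    change pairing v (a.1.1 + b.1.1) = pairing v a.1.1 + pairing v b.1.1 at h
    simp only [vanishingOrder, AddSubmonoid.coe_add, Prod.fst_add, Prod.snd_add, h]
    push_cast
    ring

/-- The real extension of the pairing with `v`. -/
def realPairing (v : ι → ℤ) : (ι → ℝ) →ₗ[ℝ] ℝ := ∑ i, (v i : ℝ) • LinearMap.proj i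

theorem realPairing_toReal (v m : ι → ℤ) : realPairing v (toReal m) = pairing v m := by
  simp [realPairing, pairing, toReal]

theorem vanishingOrder_nonneg {v : ι → ℤ} (hv : ∀ g ∈ P.generators, 0 ≤ pairing v g)
    (a : P.semigroup) : 0 ≤ P.vanishingOrder v a := by
  obtain ⟨p, ⟨u, hu, rfl⟩, c, hc, h⟩ := a.2
  have hu' : (P.minValue v : ℝ) ≤ realPairing v u := by
    refine convexHull_min (t := {u | (P.minValue v : ℝ) ≤ realPairing v u}) ?_
      (convex_halfSpace_ge (realPairing v).isLinear _) hu
    rintro _ ⟨w, hw, rfl⟩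
    rw [Set.mem_ofPred_eq, realPairing_toReal]
    exact_mod_cast Finset.inf'_le _ hw
  have hc' : 0 ≤ realPairing v c := by
    refine Submodule.span_induction (p := fun c _ => 0 ≤ realPairing v c) ?_ ?_ ?_ ?_ hc
    · rintro _ ⟨w, hw, rfl⟩
      rw [realPairing_toReal]
      exact_mod_cast hv w hw
    · simp
    · intro y z _ _ hy hz
      rw [map_add]
      exact add_nonneg hy hz
    · intro r y _ hy
      change 0 ≤ realPairing v ((r : ℝ) • y)
      rw [map_smul]
      exact mul_nonneg r.2 hy
  have key : (0 : ℝ) ≤ P.vanishingOrder v a := by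
    have h' := congrArg (realPairing v) h
    simp only [map_add, map_smul, realPairing_toReal, smul_eq_mul] at h'
    rw [vanishingOrder]
    push_cast
    rw [← h']
    have := mul_le_mul_of_nonneg_left hu' (Nat.cast_nonneg (α := ℝ) a.1.2)
    linarith
  exact_mod_cast key

end Fintype

end LatticePolyhedron

/-- Among all finite sets, the set on which `g` is negative minimises the sum of `g`. -/
theorem Finset.sum_le_sum_of_sign {ι R : Type*} [AddCommGroup R] [PartialOrder R]
    [IsOrderedAddMonoid R] [DecidableEq ι] {g : ι → R} (A B : Finset ι) (hB : ∀ i ∈ B, g i ≤ 0)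
    (hA : ∀ i ∉ B, 0 ≤ g i) : ∑ i ∈ B, g i ≤ ∑ i ∈ A, g i := by
  rw [← Finset.sum_inter_add_sum_sdiff A B g, ← Finset.sum_inter_add_sum_sdiff B A g,
    Finset.inter_comm B A]
  refine add_le_add le_rfl ((Finset.sum_nonpos fun i hi => ?_).trans
    (Finset.sum_nonneg fun i hi => ?_))
  · exact hB i (Finset.mem_sdiff.1 hi).1
  · exact hA i (Finset.mem_sdiff.1 hi).2

namespace ExpandedDegeneration

open LatticePolyhedron

variable {n : ℕ}

theorem pairing_ray (I : Finset (Fin n)) (j : Fin (n + 1)) (m : Coord n → ℤ) :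
    pairing (ray I j) m = ∑ i ∈ I, m (Sum.inl i) + m (Sum.inr j) := by
  simp [pairing, ray, Pi.single_apply]

theorem pairing_ray_ratioExp (I : Finset (Fin n)) (j : Fin (n + 1)) (k i : Fin n) :
    pairing (ray I j) (ratioExp n k i) =
      (if k.castSucc < j then 1 else 0) - if i ∈ I then 1 else 0 := by
  rw [pairing_ray]
  simp [ratioExp, Pi.single_apply]
  split_ifs <;> simp

/-! ### The facet inequalities of the polyhedron of `W[n]` -/

/-- The constant `d_{I,j}`. The minimum is attained at the product of the ratios `r_{k,i}` with
`i ∈ I` that are not divisible by `t_{j+1}`. -/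
theorem minValue_ray (I : Finset (Fin n)) (j : Fin (n + 1)) :
    (polyhedron n).minValue (ray I j) = -(I.card * (n - j : ℤ)) := by
  have hsum : ∀ A : Finset (Fin n × Fin n),
      pairing (ray I j) (∑ a ∈ A, ratioExp n a.1 a.2) =
        ∑ a ∈ A, (((if a.1.castSucc < j then 1 else 0) - if a.2 ∈ I then 1 else 0) : ℤ) := by
    intro A
    have h := map_sum (pairingHom (ray I j)) (fun a : Fin n × Fin n => ratioExp n a.1 a.2) A
    refine h.trans (Finset.sum_congr rfl fun a _ => pairing_ray_ratioExp I j a.1 a.2)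
  set B : Finset (Fin n × Fin n) :=
    Finset.univ.filter (fun k : Fin n => ¬ k.castSucc < j) ×ˢ I with hB
  have hcard : (Finset.card {k : Fin n | ¬ k.castSucc < j} : ℤ) = n - j := by
    have h1 : Finset.card {k : Fin n | k.castSucc < j} = j := by
      have := Fin.card_filter_val_lt (n := n) (m := j)
      simp only [Fin.lt_def, Fin.val_castSucc]
      rw [this]; omega
    have h2 := Finset.card_filter_add_card_filter_not (s := (Finset.univ : Finset (Fin n)))
      (fun k => k.castSucc < j)
    rw [h1, Finset.card_univ, Fintype.card_fin] at h2
    omega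
  have hBsum : pairing (ray I j) (∑ a ∈ B, ratioExp n a.1 a.2) = -(I.card * (n - j : ℤ)) := by
    rw [hsum, Finset.sum_congr rfl (g := fun _ => (-1 : ℤ))]
    · rw [Finset.sum_const, hB, Finset.card_product, nsmul_eq_mul]
      push_cast
      rw [hcard]
      ring
    · intro a ha
      simp only [hB, Finset.mem_product, Finset.mem_filter, Finset.mem_univ, true_and] at ha
      simp [ha.1, ha.2]
  apply le_antisymm
  · rw [← hBsum]
    exact Finset.inf'_le _ (Finset.mem_image_of_mem _ (Finset.mem_univ B))
  · refine Finset.le_inf' _ _ fun m hm => ?_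
    obtain ⟨A, -, rfl⟩ := Finset.mem_image.1 hm
    rw [← hBsum, hsum, hsum]
    refine Finset.sum_le_sum_of_sign A B ?_ ?_
    · intro a ha
      simp only [hB, Finset.mem_product, Finset.mem_filter, Finset.mem_univ, true_and] at ha
      simp [ha.1, ha.2]
    · intro a ha
      simp only [hB, Finset.mem_product, Finset.mem_filter, Finset.mem_univ, true_and, not_and] at ha
      split_ifs <;> simp_all

/-- The order of vanishing along `D_{I,j}` of the monomial with exponent `m` in degree `k`. -/
def rayOrder (I : Finset (Fin n)) (j : Fin (n + 1)) (m : Coord n → ℤ) (k : ℤ) : ℤ :=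
  ∑ i ∈ I, (m (Sum.inl i) + k * (n - j)) + m (Sum.inr j)

theorem vanishingOrder_ray (I : Finset (Fin n)) (j : Fin (n + 1)) (a : (polyhedron n).semigroup) :
    (polyhedron n).vanishingOrder (ray I j) a = rayOrder I j a.1.1 a.1.2 := by
  rw [vanishingOrder, pairing_ray, minValue_ray, rayOrder, Finset.sum_add_distrib]
  simp only [Finset.sum_const, nsmul_eq_mul]
  ring

theorem vanishingOrder_ray_nonneg (I : Finset (Fin n)) (j : Fin (n + 1))
    (a : (polyhedron n).semigroup) : 0 ≤ (polyhedron n).vanishingOrder (ray I j) a := by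
  refine vanishingOrder_nonneg _ (fun g hg => ?_) a
  simp only [polyhedron, Finset.mem_union, Finset.mem_image, Finset.mem_univ, true_and] at hg
  rw [pairing_ray]
  obtain (⟨i, rfl⟩ | ⟨i, rfl⟩) | ⟨i, rfl⟩ := hg
  · simp [xExp, Pi.single_apply]
    split_ifs <;> simp
  · simp only [yExp, Sum.elim_inl, Sum.elim_inr, Pi.zero_apply, add_zero]
    exact Finset.sum_nonneg fun l _ => by rw [Pi.single_apply]; split_ifs <;> simp
  · simp [tExp, Pi.single_apply]
    split_ifs <;> simp

/-- The polytope of `W[n]` is a zonotope: the Minkowski sum of the segments from the origin to the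
exponents of the ratios. -/
theorem sum_smul_ratioExp_mem {q : ℝ} (hq : 0 ≤ q) (c : Fin n × Fin n → ℝ) (h0 : ∀ a, 0 ≤ c a)
    (h1 : ∀ a, c a ≤ q) :
    ∑ a, c a • toReal (ratioExp n a.1 a.2) ∈ q • (polyhedron n).polytope := by
  obtain rfl | hq := hq.eq_or_lt
  · obtain ⟨u, hu⟩ := (polyhedron n).polytope_nonempty
    refine ⟨u, hu, ?_⟩
    have : ∀ a, c a = 0 := fun a => le_antisymm (h1 a) (h0 a)
    simp [this]
  refine ⟨∑ a, (c a / q) • toReal (ratioExp n a.1 a.2), ?_, ?_⟩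
  · have hz : ∑ a, (c a / q) • toReal (ratioExp n a.1 a.2) ∈
        ∑ a : Fin n × Fin n, convexHull ℝ {0, toReal (ratioExp n a.1 a.2)} := by
      refine Set.finsetSum_mem_finsetSum _ _ _ fun a _ => ?_
      rw [convexHull_pair, segment_eq_image']
      exact ⟨c a / q, ⟨div_nonneg (h0 a) hq.le, (div_le_one hq).2 (h1 a)⟩, by simp⟩
    rw [← convexHull_sum] at hz
    refine convexHull_mono ?_ hz
    intro u hu
    obtain ⟨g, hg, rfl⟩ := (Set.mem_fintype_sum _ _).1 hu
    classical
    refine ⟨∑ a ∈ Finset.univ.filter (fun a => g a ≠ 0), ratioExp n a.1 a.2,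
      Finset.mem_image_of_mem _ (Finset.mem_univ _), ?_⟩
    have hR : ∀ A : Finset (Fin n × Fin n), toReal (∑ a ∈ A, ratioExp n a.1 a.2) =
        ∑ a ∈ A, toReal (ratioExp n a.1 a.2) := by
      intro A; ext l; simp [toReal]
    rw [hR, Finset.sum_filter]
    refine Finset.sum_congr rfl fun a _ => ?_
    obtain h | h := hg a
    · simp [h]
    · rw [Set.mem_singleton_iff] at h
      rw [h]
      split_ifs with h'
      · rfl
      · simp only [ne_eq, not_not] at h'
        exact h'.symm
  · simp only [Finset.smul_sum, smul_smul]
    refine Finset.sum_congr rfl fun a _ => ?_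
    rw [mul_div_cancel₀ _ hq.ne']

/-- A telescoping sum. -/
theorem sum_fin_ite_sub (f : ℕ → ℝ) {j : ℕ} (hj : j ≤ n) :
    ∑ k : Fin n, (if (k : ℕ) < j then f (k + 1) - f k else 0) = f j - f 0 := by
  rw [Fin.sum_univ_eq_sum_range (fun k => if k < j then f (k + 1) - f k else 0) n,
    ← Finset.sum_filter, ← Finset.sum_range_sub f j]
  congr 1
  ext k
  simp only [Finset.mem_filter, Finset.mem_range]
  omega

/-- The inequalities of the rays `v_{I,j}` cut out the polyhedron. With
`f_i(j) = max(0, -s_i - k(n-j))`, they say `t_j ≥ ∑_i f_i(j)`, and a point that satisfies them is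
the sum of the exponents of the ratios `t_{l+2} ⋯ t_{n+1} / s_i`, `0 ≤ l < n`, with coefficients
`f_i(l+1) - f_i(l) ∈ [0, k]`, and of the exponents of the `x_i`, `y_i` and `t_j` with coefficients
`f_i(0)`, `max(0, s_i)` and `t_j - ∑_i f_i(j)`. -/
theorem mem_semigroup_of_rayOrder_nonneg {m : Coord n → ℤ} {k : ℕ}
    (h : ∀ I j, 0 ≤ rayOrder I j m k) : (m, k) ∈ (polyhedron n).semigroup := by
  classical
  set f : Fin n → ℕ → ℝ := fun i j => max 0 (-(m (Sum.inl i) : ℝ) - k * (n - j)) with hf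
  have hk : (0 : ℝ) ≤ k := Nat.cast_nonneg k
  have ht : ∀ j : Fin (n + 1), 0 ≤ (m (Sum.inr j) : ℝ) - ∑ i, f i j := by
    intro j
    -- The strongest inequality for a given `j` comes from the set of indices with `f_i(j) > 0`.
    have hI := h (Finset.univ.filter fun i => m (Sum.inl i) + k * (n - j : ℤ) < 0) j
    rw [rayOrder] at hI
    have hI' : (0 : ℝ) ≤ (∑ i with m (Sum.inl i) + k * (n - j : ℤ) < 0,
      ((m (Sum.inl i) : ℝ) + k * (n - j))) + m (Sum.inr j) := by exact_mod_cast hI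
    rw [Finset.sum_filter] at hI'
    have : ∑ i, f i j = -∑ i, (if m (Sum.inl i) + k * (n - j : ℤ) < 0 then
        ((m (Sum.inl i) : ℝ) + k * (n - j)) else 0) := by
      rw [← Finset.sum_neg_distrib]
      refine Finset.sum_congr rfl fun i _ => ?_
      split_ifs with hi
      · have hi' : (m (Sum.inl i) : ℝ) + k * (n - j) < 0 := by exact_mod_cast hi
        rw [hf]
        simp only
        rw [max_eq_right (by linarith)]
        ring
      · have hi' : 0 ≤ (m (Sum.inl i) : ℝ) + k * (n - j) := by exact_mod_cast not_lt.1 hi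
        rw [hf]
        simp only
        rw [max_eq_left (by linarith)]
        simp
    rw [this]
    linarith
  have hgen : ∀ g ∈ (polyhedron n).generators, ∀ r : ℝ, 0 ≤ r →
      r • toReal g ∈ (polyhedron n).recessionCone := fun g hg r hr =>
    Submodule.smul_mem _ (⟨r, hr⟩ : NNReal) (Submodule.subset_span ⟨g, hg, rfl⟩)
  refine ⟨_, sum_smul_ratioExp_mem hk (fun a => f a.2 (a.1 + 1) - f a.2 a.1) ?_ ?_,
    ∑ i, f i 0 • toReal (xExp n i) + ∑ i, max 0 (m (Sum.inl i) : ℝ) • toReal (yExp n i) +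
      ∑ j : Fin (n + 1), ((m (Sum.inr j) : ℝ) - ∑ i, f i j) • toReal (tExp n j), ?_, ?_⟩
  · intro a
    rw [sub_nonneg]
    refine max_le_max le_rfl ?_
    push_cast
    nlinarith
  · intro a
    rw [sub_le_iff_le_add]
    refine max_le (add_nonneg hk (le_max_left _ _)) ?_
    have := le_max_right 0 (-(m (Sum.inl a.2) : ℝ) - k * (n - (a.1 : ℕ)))
    push_cast
    linarith
  · refine add_mem (add_mem (sum_mem fun i _ => hgen _ ?_ _ (le_max_left _ _))
      (sum_mem fun i _ => hgen _ ?_ _ (le_max_left _ _))) (sum_mem fun j _ => hgen _ ?_ _ (ht j)) <;>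
    simp [polyhedron]
  · ext l
    simp only [Pi.add_apply, Finset.sum_apply, Pi.smul_apply, smul_eq_mul]
    rw [Fintype.sum_prod_type_right]
    obtain i | j := l
    · have hn := sum_fin_ite_sub (n := n) (f i) le_rfl
      simp only [Fin.is_lt, if_true] at hn
      simp only [toReal, ratioExp, xExp, yExp, tExp, Sum.elim_inl, Pi.neg_apply, Pi.single_apply,
        Pi.zero_apply]
      simp only [Int.cast_neg, Int.cast_ite, Int.cast_one, Int.cast_zero, mul_neg, mul_ite, mul_one,
        mul_zero, Finset.sum_neg_distrib, Finset.sum_ite_eq, Finset.mem_univ, if_true,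
        Finset.sum_const_zero, add_zero]
      rw [Finset.sum_comm]
      simp only [Finset.sum_ite_eq, Finset.mem_univ, if_true]
      rw [hn]
      simp only [hf, sub_self, mul_zero, sub_zero]
      obtain h' | h' := le_total 0 (m (Sum.inl i) : ℝ)
      · rw [max_eq_right h', max_eq_left (by linarith : -(m (Sum.inl i) : ℝ) ≤ 0)]; ring
      · rw [max_eq_left h', max_eq_right (by linarith : 0 ≤ -(m (Sum.inl i) : ℝ))]; ring
    · have hj := fun i => sum_fin_ite_sub (n := n) (f i) (Nat.lt_succ_iff.1 j.2)
      simp only [toReal, ratioExp, xExp, yExp, tExp, Sum.elim_inr, Pi.single_apply, Pi.zero_apply,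
        Pi.one_apply, Fin.lt_def, Fin.val_castSucc]
      simp only [Int.cast_ite, Int.cast_one, Int.cast_zero, mul_ite, mul_one,
        mul_zero, Finset.sum_ite_eq, Finset.mem_univ, if_true, Finset.sum_const_zero, add_zero]
      rw [Finset.sum_congr rfl fun i _ => hj i, Finset.sum_sub_distrib]
      ring

end ExpandedDegeneration

namespace ExpandedDegeneration

open LatticePolyhedron

variable {n : ℕ}

/-! ### Invariant sections attached to complete flags -/

/-- The exponent of an invariant section of `L^(2(n+1))` that vanishes on none of the divisors
`D_{I,j}` with `I` the set of the first `j` elements for the order `e` on `{1, …, n}`. Its `t`-part is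
forced by invariance up to a constant, and the vanishing orders then force its `s`-part. The degree
`2(n+1)`, rather than `n+1`, avoids the halves in `n j(j+1)/2`. -/
def flagExp (e : Equiv.Perm (Fin n)) : Coord n → ℤ :=
  Sum.elim (fun i => 2 * (((e i : ℕ) + 1) * (n + 2) - (n + 1) ^ 2)) (fun j => n * (j * (j + 1)))

theorem sum_range_flag (j : ℕ) :
    ∑ r ∈ Finset.range j, (2 * (((r : ℤ) + 1) * (n + 2) - (n + 1) * (j + 1))) =
      -(n * (j * (j + 1))) := by
  have h : ∀ l : ℕ, ∀ c : ℤ, ∑ r ∈ Finset.range l, (2 * (((r : ℤ) + 1) * (n + 2) - c)) =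
      (n + 2) * (l * (l + 1)) - 2 * l * c := by
    intro l c
    induction l with
    | zero => simp
    | succ l ih => rw [Finset.sum_range_succ, ih]; push_cast; ring
  rw [h]
  ring

theorem flagExp_inl_add (e : Equiv.Perm (Fin n)) (i : Fin n) (j : Fin (n + 1)) :
    flagExp e (Sum.inl i) + (((n + 1) * 2 : ℕ) : ℤ) * (n - j) =
      2 * (((e i : ℕ) + 1) * (n + 2) - (n + 1) * (j + 1)) := by
  simp only [flagExp, Sum.elim_inl]
  push_cast
  ring

theorem rayOrder_flagExp_eq_zero (e : Equiv.Perm (Fin n)) (j : Fin (n + 1)) :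
    rayOrder (Finset.univ.filter fun i => (e i : ℕ) < j) j (flagExp e) ((n + 1) * 2 : ℕ) = 0 := by
  rw [rayOrder]
  simp only [flagExp_inl_add]
  rw [Finset.sum_filter, Equiv.sum_comp e (fun r : Fin n => if (r : ℕ) < j then
      (2 * (((r : ℕ) + 1) * (n + 2) - (n + 1) * (j + 1)) : ℤ) else 0),
    Fin.sum_univ_eq_sum_range (fun r : ℕ => if r < j then
      (2 * ((r + 1) * (n + 2) - (n + 1) * (j + 1)) : ℤ) else 0) n, ← Finset.sum_filter]
  have hr : (Finset.range n).filter (· < (j : ℕ)) = Finset.range j := by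
    ext r
    simp only [Finset.mem_filter, Finset.mem_range]
    omega
  rw [hr, sum_range_flag]
  simp [flagExp]

theorem rayOrder_flagExp_nonneg (e : Equiv.Perm (Fin n)) (I : Finset (Fin n)) (j : Fin (n + 1)) :
    0 ≤ rayOrder I j (flagExp e) ((n + 1) * 2 : ℕ) := by
  rw [← rayOrder_flagExp_eq_zero e j, rayOrder, rayOrder, add_le_add_iff_right]
  refine Finset.sum_le_sum_of_sign _ _ (fun i hi => ?_) (fun i hi => ?_)
  all_goals
    rw [flagExp_inl_add]
    simp only [Finset.mem_filter, Finset.mem_univ, true_and, not_lt] at hi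
    have hj : (j : ℤ) ≤ n := by exact_mod_cast Nat.lt_succ_iff.1 j.2
    have hn : (0 : ℤ) ≤ n := Nat.cast_nonneg n
  · have hi' : ((e i : ℕ) : ℤ) + 1 ≤ j := by exact_mod_cast hi
    nlinarith
  · have hi' : (j : ℤ) ≤ (e i : ℕ) := by exact_mod_cast hi
    nlinarith

/-- The invariant section with exponent `flagExp e`. -/
def flagSection (e : Equiv.Perm (Fin n)) : (polyhedron n).semigroup :=
  ⟨(flagExp e, (n + 1) * 2), mem_semigroup_of_rayOrder_nonneg (rayOrder_flagExp_nonneg e)⟩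

theorem alpha_flagExp (e : Equiv.Perm (Fin n)) (i : Fin n) :
    alpha n (flagExp e) i = -(2 * ((i + 1) * n)) := by
  simp only [alpha, flagExp, Sum.elim_inr, Fin.val_castSucc, Fin.val_succ]
  push_cast
  ring

/-- Summation by parts on `G[n]`. -/
theorem prod_pow_mul_prod_tau_pow (N : ℕ) (n : ℕ) (t : Fin (n + 1) → ℂˣ) :
    (∏ j, t j ^ (N * (j * (j + 1)) : ℕ)) *
      ∏ i : Fin n, (∏ j ∈ Finset.Iic i.castSucc, t j) ^ (2 * ((i + 1) * N) : ℕ) =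
      (∏ j, t j) ^ (N * (n * (n + 1))) := by
  induction n with
  | zero => simp
  | succ n ih =>
    have h := ih (fun j => t j.castSucc)
    have hI : ∀ i : Fin (n + 1), ∏ j ∈ Finset.Iic i.castSucc, t j =
        ∏ j ∈ Finset.Iic i, t j.castSucc := by
      intro i
      rw [← Fin.map_castSuccEmb_Iic, Finset.prod_map]
      rfl
    rw [Fin.prod_univ_castSucc (fun j : Fin (n + 1 + 1) => t j ^ (N * (j * (j + 1)) : ℕ)),
      Fin.prod_univ_castSucc (fun i : Fin (n + 1) =>
        (∏ j ∈ Finset.Iic i.castSucc, t j) ^ (2 * ((i + 1) * N) : ℕ)), Fin.prod_univ_castSucc t]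
    simp only [hI, Fin.val_castSucc, Fin.val_last]
    have hl : Finset.Iic (Fin.last n) = Finset.univ := by
      ext j; simp [Fin.le_last]
    rw [hl]
    generalize ∏ j : Fin (n + 1), t j.castSucc ^ (N * (j * (j + 1)) : ℕ) = A at h ⊢
    generalize ∏ i : Fin n, (∏ j ∈ Finset.Iic i.castSucc, t j.castSucc) ^ (2 * ((i + 1) * N) : ℕ) = B
      at h ⊢
    generalize ∏ j : Fin (n + 1), t j.castSucc = T at h ⊢
    generalize t (Fin.last (n + 1)) = u
    calc A * u ^ (N * ((n + 1) * (n + 1 + 1))) * (B * T ^ (2 * ((n + 1) * N)))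
        = (A * B) * T ^ (2 * ((n + 1) * N)) * u ^ (N * ((n + 1) * (n + 1 + 1))) := by
          simp only [mul_assoc, mul_comm, mul_left_comm]
      _ = _ := by
          rw [h, ← pow_add, mul_pow]
          congr 2
          ring

theorem ghhAction_flagSection (e : Equiv.Perm (Fin n)) (g : G n) :
    ghhAction 2 g ((polyhedron n).monomial (flagSection e)) =
      (polyhedron n).monomial (flagSection e) := by
  have h := prod_pow_mul_prod_tau_pow n n g.1
  have hg : ∏ j, g.1 j = 1 := g.2
  rw [hg, one_pow] at h
  have hw : ghhCharacter g ^ 2 * character (flagExp e) (toTorus g) = 1 := by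
    rw [← h, mul_comm]
    congr 1
    · simp [character, toTorus, flagExp, ← zpow_natCast]
    · simp [ghhCharacter, tau, ← Finset.prod_pow, ← pow_mul, mul_comm]
  rw [AddMonoidAlgebra.ext_iff]
  ext a
  rw [ghhAction, AddMonoidAlgebra.coeff_smul, Finsupp.smul_apply, coeff_torusAction]
  by_cases ha : flagSection e = a
  · subst ha
    simp only [smul_eq_mul, ← mul_assoc]
    have := congrArg (Units.val) hw
    rw [Units.val_mul, Units.val_one] at this
    change _ * (character (flagExp e) (toTorus g) : ℂ) * _ = _
    rw [this, one_mul]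
  · simp [monomial, ha]

/-! ### Exponents of invariant sections -/

/-- Every monomial of a `G[n]`-invariant section is invariant. -/
theorem alpha_eq_of_ghhAction_eq {q : ℕ} {f : (polyhedron n).ring}
    (hf : ∀ g : G n, ghhAction q g f = f)
    {a : (polyhedron n).semigroup} (ha : a ∈ f.coeff.support) (i : Fin n) :
    alpha n a.1.1 i = -(q * ((i + 1) * n)) := by
  -- The element `t` of `G[n]` has `τ_i = 2` and all other coordinates `τ_l = 1`. As `2` is not a root
  -- of unity, it determines the `i`-th component of the weight.
  set c : ℂˣ := Units.mk0 2 two_ne_zero with hc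
  have hne : i.castSucc ≠ i.succ := Fin.castSucc_lt_succ.ne
  set t : Fin (n + 1) → ℂˣ := Pi.mulSingle i.castSucc c * Pi.mulSingle i.succ c⁻¹ with ht
  have htG : t ∈ G n := by
    change ∏ j, t j = 1
    simp [ht, Finset.prod_mul_distrib, Finset.prod_pi_mulSingle']
  have htau : ∀ l, tau ⟨t, htG⟩ l = if l = i then c else 1 := by
    intro l
    simp only [tau, ht, Pi.mul_apply, Finset.prod_mul_distrib, Finset.prod_pi_mulSingle',
      Finset.mem_Iic, Fin.le_def, Fin.val_castSucc, Fin.val_succ]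
    rcases lt_trichotomy l i with h | h | h
    · have h' := h.ne
      rw [Fin.lt_def] at h
      rw [if_neg (by omega), if_neg (by omega), if_neg h', one_mul]
    · subst h; simp
    · have h' := h.ne'
      rw [Fin.lt_def] at h
      rw [if_pos (by omega), if_pos (by omega), if_neg h', mul_inv_cancel]
  have hch : ghhCharacter ⟨t, htG⟩ = c ^ (((i : ℕ) + 1) * n) := by
    simp [ghhCharacter, htau, ite_pow]
  have hcha : character a.1.1 (toTorus ⟨t, htG⟩) = c ^ alpha n a.1.1 i := by
    have : ∀ j, t j ^ a.1.1 (Sum.inr j) =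
        (if j = i.castSucc then c ^ a.1.1 (Sum.inr i.castSucc) else 1) *
          (if j = i.succ then c⁻¹ ^ a.1.1 (Sum.inr i.succ) else 1) := by
      intro j
      simp only [ht, Pi.mul_apply, Pi.mulSingle_apply, mul_zpow]
      split_ifs <;> simp_all
    simp only [character, toTorus, Fintype.prod_sum_type, Sum.elim_inl, Sum.elim_inr, Pi.one_apply,
      one_zpow, Finset.prod_const_one, one_mul, this, Finset.prod_mul_distrib, Finset.prod_ite_eq',
      Finset.mem_univ, if_true, alpha, zpow_sub, inv_zpow]
  have h := congrArg (fun p => p.coeff a) (hf ⟨t, htG⟩)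
  simp only [ghhAction, AddMonoidAlgebra.coeff_smul, Finsupp.smul_apply, coeff_torusAction,
    smul_eq_mul, ← mul_assoc] at h
  have h1 := mul_right_cancel₀ (Finsupp.mem_support_iff.1 ha) (h.trans (one_mul _).symm)
  rw [hch, hcha, ← Units.val_mul, ← pow_mul, ← zpow_natCast, ← zpow_add] at h1
  have h2 : (2 : ℂ) ^ ((((i : ℕ) + 1) * n * q : ℕ) + alpha n a.1.1 i : ℤ) = 1 := by
    simpa [hc] using h1
  have h3 : ((2 : ℝ)) ^ ((((i : ℕ) + 1) * n * q : ℕ) + alpha n a.1.1 i : ℤ) = 1 := by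
    simpa using congrArg norm h2
  rw [zpow_eq_one_iff_right₀ (by norm_num) (by norm_num)] at h3
  push_cast at h3
  linarith

/-- The `t`-part of the exponent of an invariant monomial section is determined up to a constant. -/
theorem inr_eq_of_alpha {m : Coord n → ℤ} {k : ℕ}
    (h : ∀ i, (alpha n m i : ℚ) = -(k * ghhVector n i)) (j : Fin (n + 1)) :
    2 * (n + 1) * m (Sum.inr j) = 2 * (n + 1) * m (Sum.inr 0) + k * n * (j * (j + 1)) := by
  have hn : (n : ℚ) + 1 ≠ 0 := by positivity
  induction j using Fin.induction with
  | zero => simp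
  | succ i ih =>
    have hi := h i
    have hi' : (alpha n m i : ℚ) * (n + 1) = -(k * ((i + 1) * n)) := by
      rw [hi, ghhVector]
      field_simp
    have hz : alpha n m i * (n + 1) = -(k * ((i + 1) * n)) := by exact_mod_cast hi'
    rw [alpha] at hz
    simp only [Fin.val_castSucc] at ih
    rw [Fin.val_succ]
    push_cast
    linear_combination ih - 2 * hz

/-- The comparison of the vanishing orders along `D_{I,j}` and `D_{I,#I}`: their difference is
determined by invariance and is positive. -/
theorem vanishingOrder_ray_pos {a : (polyhedron n).semigroup} (hk : 0 < a.1.2)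
    (h : ∀ i, (alpha n a.1.1 i : ℚ) = -(a.1.2 * ghhVector n i)) {I : Finset (Fin n)}
    {j : Fin (n + 1)} (hI : I.card ≠ j) : 0 < (polyhedron n).vanishingOrder (ray I j) a := by
  have hl : I.card < n + 1 := Nat.lt_succ_of_le (by simpa using I.card_le_univ)
  have h1 := vanishingOrder_ray_nonneg I ⟨I.card, hl⟩ a
  rw [vanishingOrder_ray, rayOrder, Finset.sum_add_distrib] at h1 ⊢
  simp only [Finset.sum_const, nsmul_eq_mul] at h1 ⊢
  have h2 := inr_eq_of_alpha h j
  have h3 := inr_eq_of_alpha h ⟨I.card, hl⟩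
  simp only at h3
  generalize a.1.1 (Sum.inr j) = tj at *
  generalize a.1.1 (Sum.inr ⟨I.card, hl⟩) = tl at *
  generalize ∑ i ∈ I, a.1.1 (Sum.inl i) = S at *
  have hj : (j : ℤ) ≤ n := by exact_mod_cast Nat.lt_succ_iff.1 j.2
  have hn : (0 : ℤ) ≤ n := Nat.cast_nonneg n
  have hl' : (I.card : ℤ) ≤ n := by exact_mod_cast Nat.lt_succ_iff.1 hl
  have hl0 : (0 : ℤ) ≤ I.card := Nat.cast_nonneg _
  have hj0 : (0 : ℤ) ≤ (j : ℕ) := Nat.cast_nonneg _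
  have hne : (I.card : ℤ) ≠ (j : ℕ) := by exact_mod_cast hI
  have hk' : (0 : ℤ) < a.1.2 := by exact_mod_cast hk
  generalize (I.card : ℤ) = l at *
  generalize ((j : ℕ) : ℤ) = j' at *
  generalize (a.1.2 : ℤ) = k at *
  have key : 0 < (l - j') * (2 * l + n * (l - j' - 1)) := by
    rcases lt_or_gt_of_ne hne with h | h
    · refine mul_pos_of_neg_of_neg (by linarith) ?_
      nlinarith
    · refine mul_pos (by linarith) ?_
      nlinarith
  have hkey := mul_pos hk' key
  have h1' : 0 ≤ (2 * (n + 1) : ℤ) * (S + l * (k * (n - l)) + tl) := mul_nonneg (by positivity) h1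
  refine (mul_pos_iff_of_pos_left (by positivity : (0 : ℤ) < 2 * (n + 1))).1 ?_
  nlinarith

/-! ### Nonvanishing of flag sections -/

/-- If a monomial section vanishes on every `D_{I,j}` with `#I ≠ j`, then the sets `I` for which it has
order zero along some `D_{I,j}` are initial segments for one order on `{1, …, n}`: any order that sorts
the `s`-part of the exponent. -/
theorem exists_perm_of_vanishingOrder_pos (a : (polyhedron n).semigroup)
    (ha : ∀ (I : Finset (Fin n)) (j : Fin (n + 1)), I.card ≠ j →
      0 < (polyhedron n).vanishingOrder (ray I j) a) :
    ∃ e : Equiv.Perm (Fin n), ∀ (I : Finset (Fin n)) (j : Fin (n + 1)),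
      (polyhedron n).vanishingOrder (ray I j) a = 0 →
        I = Finset.univ.filter fun i => (e i : ℕ) < j := by
  set s : Fin n → ℤ := fun i => a.1.1 (Sum.inl i) with hs
  set σ := Tuple.sort s with hσ
  have hmono : Monotone (s ∘ σ) := Tuple.monotone_sort s
  refine ⟨σ.symm, fun I j h0 => ?_⟩
  have hcard : I.card = j := by
    by_contra hne
    exact (ha I j hne).ne' h0
  -- Removing an element from `I`, or adding one, must increase the vanishing order.
  have hin : ∀ i ∈ I, s i + a.1.2 * (n - j) < 0 := by
    intro i hi
    have hc := Finset.card_erase_add_one hi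
    have h1 := ha (I.erase i) j (by omega)
    rw [vanishingOrder_ray, rayOrder] at h0 h1
    rw [← Finset.add_sum_erase _ _ hi] at h0
    simp only [hs]
    linarith
  have hout : ∀ i ∉ I, 0 < s i + a.1.2 * (n - j) := by
    intro i hi
    have h1 := ha (insert i I) j (by rw [Finset.card_insert_of_notMem hi]; omega)
    rw [vanishingOrder_ray, rayOrder] at h0 h1
    rw [Finset.sum_insert hi] at h1
    simp only [hs]
    linarith
  have hlower : ∀ r r' : Fin n, r' ≤ r → σ r ∈ I → σ r' ∈ I := by
    intro r r' hr h
    by_contra h'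
    have h1 := hin _ h
    have h2 := hout _ h'
    have h3 : s (σ r') ≤ s (σ r) := hmono hr
    linarith
  have hJ : (I.map σ.symm.toEmbedding).card = j := by rw [Finset.card_map, hcard]
  ext i
  simp only [Finset.mem_filter, Finset.mem_univ, true_and]
  have hmem : ∀ r, r ∈ I.map σ.symm.toEmbedding ↔ σ r ∈ I := by
    intro r
    simp [Finset.mem_map_equiv]
  constructor
  · intro hi
    have hsub : Finset.Iic (σ.symm i) ⊆ I.map σ.symm.toEmbedding := fun r hr =>
      (hmem r).2 (hlower _ _ (Finset.mem_Iic.1 hr) (by simpa using hi))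
    have := Finset.card_le_card hsub
    rw [Fin.card_Iic, hJ] at this
    omega
  · intro hi
    by_contra hiI
    have hsub : I.map σ.symm.toEmbedding ⊆ Finset.Iio (σ.symm i) := fun r hr => by
      rw [Finset.mem_Iio]
      by_contra hlt
      exact hiI (by simpa using hlower _ _ (not_lt.1 hlt) ((hmem r).1 hr))
    have := Finset.card_le_card hsub
    rw [Fin.card_Iio, hJ] at this
    omega

/-- If a monomial section `χ^a` of positive degree vanishes on every `D_{I,j}` with `#I ≠ j`, then some
power of it is divisible by the section of a complete flag. -/
theorem exists_nsmul_eq_flagSection_add (a : (polyhedron n).semigroup) (hk : 0 < a.1.2)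
    (ha : ∀ (I : Finset (Fin n)) (j : Fin (n + 1)), I.card ≠ j →
      0 < (polyhedron n).vanishingOrder (ray I j) a) :
    ∃ (e : Equiv.Perm (Fin n)) (N : ℕ) (c : (polyhedron n).semigroup),
      N • a = flagSection e + c := by
  obtain ⟨e, he⟩ := exists_perm_of_vanishingOrder_pos a ha
  set o : Finset (Fin n) → Fin (n + 1) → ℤ := fun I j => rayOrder I j (flagExp e) ((n + 1) * 2 : ℕ)
  have ho : ∀ I j, 0 ≤ o I j := rayOrder_flagExp_nonneg e
  set N : ℕ := ∑ I, ∑ j, (o I j).toNat + (n + 1) * 2 with hN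
  -- `N` bounds the orders of the flag section from above, and `N • a` has at least its degree.
  have hNo : ∀ I j, o I j ≤ N := by
    intro I j
    have h1 : (o I j).toNat ≤ ∑ j, (o I j).toNat :=
      Finset.single_le_sum (f := fun j => (o I j).toNat) (fun _ _ => Nat.zero_le _)
        (Finset.mem_univ j)
    have h2 : ∑ j, (o I j).toNat ≤ ∑ I, ∑ j, (o I j).toNat :=
      Finset.single_le_sum (f := fun I => ∑ j, (o I j).toNat) (fun _ _ => Nat.zero_le _)
        (Finset.mem_univ I)
    have := ho I j
    omega
  have hNk : (n + 1) * 2 ≤ N * a.1.2 :=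
    (Nat.le_add_left _ _).trans (Nat.le_mul_of_pos_right N hk)
  refine ⟨e, N, ⟨(N • a.1.1 - flagExp e, N * a.1.2 - (n + 1) * 2),
    mem_semigroup_of_rayOrder_nonneg fun I j => ?_⟩, ?_⟩
  · have heq : rayOrder I j (N • a.1.1 - flagExp e) ((N * a.1.2 - (n + 1) * 2 : ℕ) : ℤ) =
        N * (polyhedron n).vanishingOrder (ray I j) a - o I j := by
      rw [vanishingOrder_ray]
      simp only [o, rayOrder, Nat.cast_sub hNk, mul_add, Finset.mul_sum]
      rw [← sub_sub, add_sub_right_comm, ← Finset.sum_sub_distrib, add_sub_assoc]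
      simp only [Pi.sub_apply, Pi.smul_apply]
      simp only [nsmul_eq_mul]
      congr 1
      refine Finset.sum_congr rfl fun i _ => ?_
      push_cast
      ring
    rw [heq]
    obtain h | h := (vanishingOrder_ray_nonneg I j a).eq_or_lt
    · have h0 : o I j = 0 := by
        rw [he I j h.symm]
        exact rayOrder_flagExp_eq_zero e j
      rw [← h, h0]
      simp
    · have := hNo I j
      nlinarith
  · apply Subtype.ext
    refine Prod.ext ?_ ?_
    · simp [flagSection]
    · simp only [flagSection, AddSubmonoid.coe_add, AddSubmonoidClass.coe_nsmul, Prod.smul_snd,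
        Prod.snd_add, smul_eq_mul]
      omega

/-- Off the divisors `D_{I,j}` with `#I ≠ j`, one of the invariant sections `flagSection e` does not
vanish. -/
theorem exists_flagSection_mem_nonvanishingFace {x : W n}
    (hx : ∀ (I : Finset (Fin n)) (j : Fin (n + 1)), I.card ≠ j → x ∉ D I j) :
    ∃ e : Equiv.Perm (Fin n), flagSection e ∈ (polyhedron n).nonvanishingFace x := by
  classical
  obtain ⟨a₀, ha₀, hk⟩ := (polyhedron n).exists_degree_pos_mem_nonvanishingFace x
  have hD : ∀ p : Finset (Fin n) × Fin (n + 1), ∃ b ∈ (polyhedron n).nonvanishingFace x,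
      p.1.card ≠ p.2 → 0 < (polyhedron n).vanishingOrder (ray p.1 p.2) b := by
    intro p
    by_cases hp : p.1.card = p.2
    · exact ⟨0, zero_mem _, fun h => absurd hp h⟩
    · by_contra! h
      exact hx p.1 p.2 hp fun b hb hbx => (h b hbx).2.not_gt hb
  choose b hb hbpos using hD
  -- The sum of the `b p` has positive order along all the `D_{I,j}` with `#I ≠ j` at once.
  have ha : a₀ + ∑ p, b p ∈ (polyhedron n).nonvanishingFace x :=
    add_mem ha₀ (sum_mem fun p _ => hb p)
  obtain ⟨e, N, c, h⟩ := exists_nsmul_eq_flagSection_add (a₀ + ∑ p, b p)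
    (by rw [AddSubmonoid.coe_add, Prod.snd_add]; omega) (fun I j hI => by
      have h1 : (polyhedron n).vanishingOrder (ray I j) (a₀ + ∑ p, b p) =
          (polyhedron n).vanishingOrder (ray I j) a₀ +
            ∑ p, (polyhedron n).vanishingOrder (ray I j) (b p) := by
        have := map_add ((polyhedron n).vanishingOrderHom (ray I j)) a₀ (∑ p, b p)
        rw [map_sum] at this
        exact this
      rw [h1]
      refine add_pos_of_nonneg_of_pos (vanishingOrder_ray_nonneg _ _ _) ?_
      exact Finset.sum_pos' (fun p _ => vanishingOrder_ray_nonneg _ _ _)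
        ⟨(I, j), Finset.mem_univ _, hbpos (I, j) hI⟩)
  refine ⟨e, (polyhedron n).mem_nonvanishingFace_of_add_mem (b := c) ?_⟩
  rw [← h]
  exact nsmul_mem ha N

end ExpandedDegeneration

/-! ### The stable base locus and the unstable locus -/

open ExpandedDegeneration LatticePolyhedron in
theorem mainTheorem5 (n : ℕ) :
    ExpandedDegeneration.stableBaseLocus n = (ExpandedDegeneration.semistableLocus n)ᶜ ∧
    (ExpandedDegeneration.semistableLocus n)ᶜ =
      ⋃ (I : Finset (Fin n)) (j : Fin (n + 1)) (_ : I.card ≠ (j : ℕ)),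
        ExpandedDegeneration.D I j := by
  have hn : (n : ℚ) + 1 ≠ 0 := by positivity
  have hunstable : (semistableLocus n)ᶜ =
      ⋃ (I : Finset (Fin n)) (j : Fin (n + 1)) (_ : I.card ≠ (j : ℕ)), D I j := by
    ext x
    simp only [Set.mem_iUnion, exists_prop]
    constructor
    · intro hx
      by_contra! h
      obtain ⟨e, he⟩ := exists_flagSection_mem_nonvanishingFace h
      exact hx ⟨2, two_pos, (polyhedron n).monomial (flagSection e),
        AddMonoidAlgebra.single_mem_gradeBy _ _ _, ghhAction_flagSection e, he⟩
    · rintro ⟨I, j, hI, hx⟩ ⟨q, hq, f, hf, hinv, hfx⟩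
      obtain ⟨a, ha, hax⟩ := (polyhedron n).exists_mem_nonvanishingFace hfx
      have hdeg : a.1.2 = (n + 1) * q := hf a ha
      refine hx a (vanishingOrder_ray_pos (by rw [hdeg]; positivity) (fun i => ?_) hI) hax
      rw [alpha_eq_of_ghhAction_eq hinv ha i, hdeg, ghhVector]
      push_cast
      field_simp
  refine ⟨?_, hunstable⟩
  rw [hunstable]
  ext x
  simp only [stableBaseLocus, InvariantDivisor.support, Set.mem_iInter, Set.mem_iUnion, exists_prop]
  constructor
  · intro hx
    by_contra! h
    obtain ⟨e, he⟩ := exists_flagSection_mem_nonvanishingFace h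
    obtain ⟨I, j, hne, hxD⟩ := hx ((n + 1) * 2) (by positivity) _
      ⟨flagSection e, rfl, fun i => by
        change (alpha n (flagExp e) i : ℚ) = _
        rw [alpha_flagExp, ghhVector]
        push_cast
        field_simp, rfl⟩
    exact hxD _ ((vanishingOrder_ray_nonneg I j _).lt_of_ne' hne) he
  · rintro ⟨I, j, hI, hx⟩ k hk c ⟨a, rfl, ha, rfl⟩
    exact ⟨I, j, (vanishingOrder_ray_pos hk ha hI).ne', hx⟩
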